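/- Let $D\ge 1$ be an integer and let $L,M,a,T,\sigma>0$ and $0\le b\le D-1$ be real numbers. Let $\operatorname{Lip}(L,M)$ be the set of $L$-Lipschitz vector fields $f:\mathbb{R}^D\to\mathbb{R}^D$ with $\|f(x)\|\le M$ for all $x$ (Euclidean norm); for such $f$ let $\phi_f(x,\cdot)$ be the unique global solution of $y'=f(y)$, $y(0)=x$. Let $\mathcal{P}(a,b)$ be the set of probability distributions $\mu$ on $\mathbb{R}^D$ such that $\mu(B(x,R))\ge\min(aR^b,1)$ for all $x\in\operatorname{supp}(\mu)$ and all $R>0$, where $B(x,R)$ is the Euclidean ball. For $n,m\ge1$ one observes $X_1,\dots,X_n$, drawn independently from $\mu$, and $$Y_{i,j}=\phi_f(X_i,t_j)+\sigma\varepsilon_{i,j},\qquad t_j=\frac{jT}{m},\qquad 1\le i\le n,\ 1\le j\le m,$$ where the $\varepsilon_{i,j}$ are independent standard Gaussian vectors in $\mathbb{R}^D$, independent of $X_1,\dots,X_n$. Put $\operatorname{Env}_f(\mathcal{X},T)=\{\phi_f(x,t): x\in\mathcal{X},\ t\in[0,T]\}$. Then there is a constant $K>0$, depending only on $L,M,a,b,D,T,\sigma$,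 such that for all sufficiently large $n$ and $m$ $$\inf_{\hat f}\ \sup_{\substack{f\in\operatorname{Lip}(L,M)\\ \mu\in\mathcal{P}(a,b)}}\ \sup_{x\in\operatorname{Env}_f(\operatorname{supp}(\mu),T)}\mathbb{E}\bigl[\|\hat f(x)-f(x)\|\bigr]\ \ge\ K\max\left(\Bigl(\frac1{nm}\Bigr)^{\frac1{5+b}},\ \Bigl(\frac1n\Bigr)^{\frac1b},\ \frac1m\right),$$ where the infimum is over all estimators $\hat f$ of $f$, i.e. all measurable functions of the data $(X_i)_i,(Y_{i,j})_{i,j}$ with values in the vector fields on $\mathbb{R}^D$. For $b=0$ the term $(1/n)^{1/b}$ is read as $0$. -/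

import Mathlib

open MeasureTheory ProbabilityTheory
open scoped ENNReal NNReal

namespace OdeRegression

/-- The ambient space `ℝ^D` with its Euclidean norm. -/
abbrev Vec (D : ℕ) : Type := EuclideanSpace ℝ (Fin D)

/-- `Lip(L,M)`: the `L`-Lipschitz vector fields on `ℝ^D` whose norm is bounded by `M`. -/
def Lip (D : ℕ) (L M : ℝ) : Set (Vec D → Vec D) :=
  {f | (∀ x y, ‖f x - f y‖ ≤ L * ‖x - y‖) ∧ ∀ x, ‖f x‖ ≤ M}

/-- `y` is a global solution of the autonomous equation `y' = f(y)` with `y(0) = x`. -/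
def IsSolution {D : ℕ} (f : Vec D → Vec D) (x : Vec D) (y : ℝ → Vec D) : Prop :=
  y 0 = x ∧ ∀ t, HasDerivAt y (f (y t)) t

theorem Lip.lipschitzWith {D : ℕ} {L M : ℝ} {f : Vec D → Vec D} (hf : f ∈ Lip D L M) :
    LipschitzWith L.toNNReal f := by
  refine LipschitzWith.of_dist_le_mul fun x y => ?_
  rw [dist_eq_norm, dist_eq_norm]
  exact (hf.1 x y).trans (mul_le_mul_of_nonneg_right (Real.le_coe_toNNReal L) (norm_nonneg _))

/-- Uniqueness in the Cauchy-Lipschitz theorem. -/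
theorem IsSolution.unique {D : ℕ} {L M : ℝ} {f : Vec D → Vec D} (hf : f ∈ Lip D L M)
    {x : Vec D} {y z : ℝ → Vec D} (hy : IsSolution f x y) (hz : IsSolution f x z) : y = z := by
  refine ODE_solution_unique_univ (v := fun _ => f) (s := fun _ => Set.univ) (t₀ := 0)
    (K := L.toNNReal) (fun _ => (Lip.lipschitzWith hf).lipschitzOnWith)
    (fun t => ⟨hy.2 t, trivial⟩) (fun t => ⟨hz.2 t, trivial⟩) ?_
  rw [hy.1, hz.1]

/-- Global existence in the Cauchy-Lipschitz theorem. -/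
theorem exists_isSolution {D : ℕ} {L M : ℝ} {f : Vec D → Vec D} (hf : f ∈ Lip D L M)
    (x : Vec D) : ∃ y, IsSolution f x y := by
  have hM : 0 ≤ M := (norm_nonneg _).trans (hf.2 x)
  have hloc : ∀ k : ℕ, ∃ y : ℝ → Vec D, y 0 = x ∧
      ∀ t ∈ Set.Ioo (-((k : ℝ) + 1)) ((k : ℝ) + 1), HasDerivAt y (f (y t)) t := by
    intro k
    have hk : (0 : ℝ) ≤ (k : ℝ) + 1 := by positivity
    have h0 : (0 : ℝ) ∈ Set.Icc (-((k : ℝ) + 1)) ((k : ℝ) + 1) := ⟨by linarith, hk⟩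
    have hpl : IsPicardLindelof (fun _ => f) (⟨0, h0⟩ : Set.Icc (-((k : ℝ) + 1)) ((k : ℝ) + 1)) x
        (M.toNNReal * ((k : ℝ≥0) + 1)) 0 M.toNNReal L.toNNReal := by
      refine ⟨fun _ _ => (Lip.lipschitzWith hf).lipschitzOnWith, fun _ _ => continuousOn_const,
        fun _ _ z _ => (hf.2 z).trans (Real.le_coe_toNNReal M), ?_⟩
      simp
    obtain ⟨y, hy0, hy⟩ := hpl.exists_eq_forall_mem_Icc_hasDerivWithinAt₀
    exact ⟨y, hy0, fun t ht =>
      (hy t (Set.Ioo_subset_Icc_self ht)).hasDerivAt (Icc_mem_nhds ht.1 ht.2)⟩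
  choose y hy0 hy using hloc
  have hagree : ∀ k l : ℕ, k ≤ l →
      Set.EqOn (y k) (y l) (Set.Ioo (-((k : ℝ) + 1)) ((k : ℝ) + 1)) := by
    intro k l hkl
    have hkl' : (k : ℝ) ≤ l := by exact_mod_cast hkl
    have hk : (0 : ℝ) ≤ k := by positivity
    refine ODE_solution_unique_of_mem_Ioo (v := fun _ => f) (s := fun _ => Set.univ) (t₀ := 0)
      (K := L.toNNReal) (fun _ _ => (Lip.lipschitzWith hf).lipschitzOnWith)
      ⟨by linarith, by linarith⟩ (fun t ht => ⟨hy k t ht, trivial⟩)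
      (fun t ht => ⟨hy l t ⟨?_, ?_⟩, trivial⟩) ?_
    · have := ht.1; linarith
    · have := ht.2; linarith
    · rw [hy0, hy0]
  have hmem : ∀ (k : ℕ) (t : ℝ), |t| < (k : ℝ) + 1 →
      t ∈ Set.Ioo (-((k : ℝ) + 1)) ((k : ℝ) + 1) := fun k t h => abs_lt.mp h
  refine ⟨fun t => y ⌈|t|⌉₊ t, by simp [hy0], fun t => ?_⟩
  have ht : |t| < (⌈|t|⌉₊ : ℝ) + 1 := (Nat.le_ceil _).trans_lt (lt_add_one _)
  have hev : (fun s => y ⌈|s|⌉₊ s) =ᶠ[nhds t] y ⌈|t|⌉₊ := by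
    filter_upwards [Ioo_mem_nhds (hmem _ t ht).1 (hmem _ t ht).2] with s hs
    have hs' : |s| < (⌈|s|⌉₊ : ℝ) + 1 := (Nat.le_ceil _).trans_lt (lt_add_one _)
    rcases le_total ⌈|s|⌉₊ ⌈|t|⌉₊ with h | h
    · exact hagree _ _ h (hmem _ s hs')
    · exact (hagree _ _ h hs).symm
  exact (hy _ t (hmem _ t ht)).congr_of_eventuallyEq hev

open Classical in
/-- The flow `φ(x,t) = y_x(t)` of `f`. For `f ∈ Lip(L,M)` it is characterized by
`isSolution_flow` and `IsSolution.unique`; the second branch is then never used. -/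
noncomputable def flow {D : ℕ} (f : Vec D → Vec D) (x : Vec D) : ℝ → Vec D :=
  if h : ∃ y, IsSolution f x y then h.choose else fun _ => x

theorem isSolution_flow {D : ℕ} {L M : ℝ} {f : Vec D → Vec D} (hf : f ∈ Lip D L M)
    (x : Vec D) : IsSolution f x (flow f x) := by
  have h := exists_isSolution hf x
  rw [flow, dif_pos h]
  exact h.choose_spec

/-- `P(a,b)`: the `(a,b)`-standard probability distributions on `ℝ^D`. -/
def Standard (D : ℕ) (a b : ℝ) : Set (Measure (Vec D)) :=
  {μ | IsProbabilityMeasure μ ∧ ∀ x ∈ μ.support, ∀ R : ℝ, 0 < R →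
    ENNReal.ofReal (min (a * R ^ b) 1) ≤ μ (Metric.closedBall x R)}

/-- `Env_f(𝒳,T)`: the points visited before time `T` by a trajectory started in `𝒳`. -/
def Env {D : ℕ} (f : Vec D → Vec D) (𝒳 : Set (Vec D)) (T : ℝ) : Set (Vec D) :=
  {z | ∃ x ∈ 𝒳, ∃ t ∈ Set.Icc (0 : ℝ) T, flow f x t = z}

/-- The regular grid `t_j = jT/m`, `j = 1, …, m` (with `j = 0, …, m-1` standing for
`1, …, m`). -/
noncomputable def gridTime (T : ℝ) (m : ℕ) (j : Fin m) : ℝ := ((j : ℝ) + 1) * T / m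

/-- A data set: the initial values `X_i` and the noisy observations `Y_{i,j}`. -/
abbrev Data (D n m : ℕ) : Type := (Fin n → Vec D) × (Fin n → Fin m → Vec D)

/-- The data produced by the initial values `X` and the noise variables `ε`:
`Y_{i,j} = φ(X_i, t_j) + σ ε_{i,j}`. -/
noncomputable def observe {D n m : ℕ} (f : Vec D → Vec D) (T σ : ℝ)
    (ω : (Fin n → Vec D) × (Fin n → Fin m → Vec D)) : Data D n m :=
  (ω.1, fun i j => flow f (ω.1 i) (gridTime T m j) + σ • ω.2 i j)

/-- The joint law of `(X, ε)`: the `X_i` are i.i.d. with law `μ`, the `ε_{i,j}` are i.i.d.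
standard `D`-variate Gaussian, and `X` and `ε` are independent. -/
noncomputable def sampleLaw {D : ℕ} (μ : Measure (Vec D)) (n m : ℕ) :
    Measure ((Fin n → Vec D) × (Fin n → Fin m → Vec D)) :=
  (Measure.pi fun _ : Fin n => μ).prod
    (Measure.pi fun _ : Fin n => Measure.pi fun _ : Fin m => stdGaussian (Vec D))

/-- Estimators of the vector field: maps from data sets to vector fields whose value at every
point is a measurable function of the data. -/
def estimators (D n m : ℕ) : Set (Data D n m → Vec D → Vec D) :=
  {fhat | ∀ x, Measurable fun d => fhat d x}

/-- The pointwise risk `𝔼 ‖fhat(x) - f(x)‖` (possibly infinite) of the estimator `fhat`. -/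
noncomputable def risk {D n m : ℕ} (fhat : Data D n m → Vec D → Vec D) (f : Vec D → Vec D)
    (μ : Measure (Vec D)) (T σ : ℝ) (x : Vec D) : ℝ≥0∞ :=
  ∫⁻ ω, ‖fhat (observe f T σ ω) x - f x‖ₑ ∂(sampleLaw μ n m)

/-- The minimax pointwise risk over `Lip(L,M) × P(a,b)` and over the envelope. -/
noncomputable def minimaxRisk (D n m : ℕ) (L M a b T σ : ℝ) : ℝ≥0∞ :=
  ⨅ fhat ∈ estimators D n m, ⨆ f ∈ Lip D L M, ⨆ μ ∈ Standard D a b,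
    ⨆ x ∈ Env f μ.support T, risk fhat f μ T σ x

/-- The rate `max((1/(nm))^{1/(5+b)}, (1/n)^{1/b}, 1/m)`. For `b = 0` the term `(1/n)^{1/b}` is
read as its limit for `b → 0+` (for `n ≥ 2`), namely `0`. -/
noncomputable def rate (n m : ℕ) (b : ℝ) : ℝ :=
  max ((1 / ((n : ℝ) * m)) ^ (1 / (5 + b)))
    (max (if b = 0 then 0 else (1 / (n : ℝ)) ^ (1 / b)) (1 / (m : ℝ)))

end OdeRegression

namespace OdeRegression

/-! The proof is Le Cam's two-point method. One field is constant, of speed `v` along an axis. The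
other has speed `v / (1 + c h'(x i))` along the same axis, where `h = hump r` is supported on `[0,
r]` and `c` is of order `r⁻²`. As `h''` is of order `r²`, the Lipschitz constant stays bounded,
while the two fields differ by order `r` inside the slab `0 < x i < r`. Crossing the slab takes `∫
(1 + c h') / v = r / v` for both, because `h` vanishes at both ends. Hence trajectories started
where `h` vanishes agree again beyond the slab (`flow_slabField_of_le`), and those from `0` are
never more than `r²` apart. A trajectory from `0` is thus informative only at the at most `m r / (v
T)` grid times before it leaves the slab, and carries information of order `m r⁵` in total
(`separation_slabField_zero_le`).

The initial law has mass `p` at `0` and `1 - p` on the exit face of the slab, from where the two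
fields cannot be told apart. It is admissible if `p = 1` or `a r ^ b ≤ p ≤ 1/2`. Given the initial
values, passing from one field to the other translates the Gaussian noise, so the testing bound
`HasShiftDensity.le_lintegral_add` yields a risk of order at least `r (p e^{-S} + 1 - p) ^ n` with
`S` at most of order `m r⁵` (`exists_lower_bound`).

Three choices give the three rates. If `r ^ (5 + b) = 1 / (n m)` and `p` is at most of order `r ^
b`, then `n p S` is bounded. If `p = 1 / (2 n)` and `r` is of order `n ^ (-1/b)`, then with
probability at least `1/2` no trajectory starts at `0`. If `p = 1` and `r = v T / m`, the slab has
been crossed by the first grid time and `S = 0`. -/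

/-! ### Gaussian translates and two-point testing -/

/-- `ν` is symmetric, and its translate by `δ` has the density `exp (ℓ - s / 2)` with respect to
`ν`, for an odd function `ℓ` (the conclusion of the Cameron-Martin theorem). -/
structure HasShiftDensity {E : Type*} [MeasurableSpace E] [AddCommGroup E] (ν : Measure E)
    (δ : E) (ℓ : E → ℝ) (s : ℝ) : Prop where
  measurable : Measurable ℓ
  odd : ∀ x, ℓ (-x) = -ℓ x
  symm : ν.map (fun x => -x) = ν
  shift : ν.map (fun x => x + δ) = ν.withDensity fun x => ENNReal.ofReal (Real.exp (ℓ x - s / 2))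

theorem hasShiftDensity_gaussianReal (δ : ℝ) :
    HasShiftDensity (gaussianReal 0 1) δ (fun x => δ * x) (δ ^ 2) where
  measurable := by fun_prop
  odd x := by ring
  symm := by simpa using gaussianReal_map_neg (μ := 0) (v := 1)
  shift := by
    rw [gaussianReal_map_add_const, gaussianReal_of_var_ne_zero _ one_ne_zero,
      gaussianReal_of_var_ne_zero _ one_ne_zero,
      ← withDensity_mul _ (measurable_gaussianPDF _ _) (by fun_prop)]
    congr 1
    funext x
    simp only [Pi.mul_apply, gaussianPDF]
    rw [← ENNReal.ofReal_mul (gaussianPDFReal_nonneg _ _ _), gaussianPDFReal, gaussianPDFReal,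
      mul_assoc _ (Real.exp _), ← Real.exp_add]
    congr 3
    simp
    ring

theorem lintegral_pi_prod {ι : Type*} [Fintype ι] {E : ι → Type*} [∀ i, MeasurableSpace (E i)]
    (ν : ∀ i, Measure (E i)) [∀ i, IsProbabilityMeasure (ν i)] {w : ∀ i, E i → ℝ≥0∞}
    (hw : ∀ i, Measurable (w i)) :
    ∫⁻ x, ∏ i, w i (x i) ∂Measure.pi ν = ∏ i, ∫⁻ y, w i y ∂ν i := by
  have h := lintegral_prod_eq_prod_lintegral_of_indepFun Finset.univ
    (fun i (x : ∀ i, E i) => w i (x i)) (iIndepFun_pi (μ := ν) fun i => (hw i).aemeasurable)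
    (fun i => (hw i).comp (measurable_pi_apply i))
  refine h.trans (Finset.prod_congr rfl fun i _ => ?_)
  exact (measurePreserving_eval ν i).lintegral_comp (hw i)

theorem pi_withDensity {ι : Type*} [Fintype ι] {E : ι → Type*} [∀ i, MeasurableSpace (E i)]
    (ν : ∀ i, Measure (E i)) [∀ i, IsProbabilityMeasure (ν i)] (w : ∀ i, E i → ℝ≥0∞)
    (hw : ∀ i, Measurable (w i)) [∀ i, SigmaFinite ((ν i).withDensity (w i))] :
    (Measure.pi fun i => (ν i).withDensity (w i)) =
      (Measure.pi ν).withDensity fun x => ∏ i, w i (x i) := by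
  refine (Measure.pi_eq fun s hs => ?_)
  rw [withDensity_apply _ (MeasurableSet.univ_pi hs),
    ← lintegral_indicator (MeasurableSet.univ_pi hs)]
  have h1 : (Set.univ.pi s).indicator (fun x => ∏ i, w i (x i)) =
      fun x => ∏ i, (s i).indicator (w i) (x i) := by
    funext x
    by_cases hx : x ∈ Set.univ.pi s
    · rw [Set.indicator_of_mem hx]
      exact Finset.prod_congr rfl fun i _ => (Set.indicator_of_mem (hx i trivial) _).symm
    · rw [Set.indicator_of_notMem hx]
      obtain ⟨i, hi⟩ : ∃ i, x i ∉ s i := by simpa [Set.mem_pi] using hx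
      exact (Finset.prod_eq_zero (Finset.mem_univ i) (Set.indicator_of_notMem hi _)).symm
  have hm : ∀ i, Measurable ((s i).indicator (w i)) := fun i => (hw i).indicator (hs i)
  rw [h1]
  refine (lintegral_pi_prod ν hm).trans (Finset.prod_congr rfl fun i _ => ?_)
  rw [withDensity_apply _ (hs i), ← lintegral_indicator (hs i)]

/-- Densities multiply over independent coordinates, so the exponents add up, and a sum of odd
functions is odd. This carries the scalar case to vectors and then to the whole noise array. -/
theorem HasShiftDensity.pi {ι : Type*} [Fintype ι] {E : ι → Type*} [∀ i, MeasurableSpace (E i)]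
    [∀ i, AddCommGroup (E i)] [∀ i, MeasurableAdd (E i)] [∀ i, MeasurableNeg (E i)]
    {ν : ∀ i, Measure (E i)} [∀ i, IsProbabilityMeasure (ν i)] {δ : ∀ i, E i}
    {ℓ : ∀ i, E i → ℝ} {s : ι → ℝ} (h : ∀ i, HasShiftDensity (ν i) (δ i) (ℓ i) (s i)) :
    HasShiftDensity (Measure.pi ν) δ (fun x => ∑ i, ℓ i (x i)) (∑ i, s i) where
  measurable := Finset.measurable_sum _ fun i _ => (h i).measurable.comp (measurable_pi_apply i)
  odd x := by simp [(h _).odd]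
  symm := by
    have := Measure.pi_map_pi (μ := ν) (f := fun i (x : E i) => -x)
      (hμ := fun i => by rw [(h i).symm]; infer_instance) fun i => measurable_neg.aemeasurable
    simp only [(h _).symm] at this
    exact this
  shift := by
    have hp : ∀ i, IsProbabilityMeasure ((ν i).map fun x => x + δ i) := fun i =>
      Measure.isProbabilityMeasure_map (measurable_add_const (δ i)).aemeasurable
    have h1 := Measure.pi_map_pi (μ := ν) (f := fun i (x : E i) => x + δ i)
      (hμ := fun i => inferInstance) fun i => (measurable_add_const (δ i)).aemeasurable
    have hsf : ∀ i, SigmaFinite ((ν i).withDensity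
        fun x => ENNReal.ofReal (Real.exp (ℓ i x - s i / 2))) := fun i => by
      rw [← (h i).shift]; infer_instance
    have h2 := pi_withDensity ν (fun i x => ENNReal.ofReal (Real.exp (ℓ i x - s i / 2)))
      fun i => by have := (h i).measurable; fun_prop
    simp only [(h _).shift] at h1
    refine (h1.trans h2).trans ?_
    congr 1
    funext x
    rw [← ENNReal.ofReal_prod_of_nonneg fun i _ => (Real.exp_pos _).le, ← Real.exp_sum,
      Finset.sum_sub_distrib, Finset.sum_div]

theorem map_withDensity_comp {E F : Type*} [MeasurableSpace E] [MeasurableSpace F]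
    {e : E → F} (he : Measurable e) (ν : Measure E) {w : F → ℝ≥0∞} (hw : Measurable w) :
    (ν.withDensity fun x => w (e x)).map e = (ν.map e).withDensity w := by
  ext t ht
  rw [Measure.map_apply he ht, withDensity_apply _ (he ht), withDensity_apply _ ht,
    setLIntegral_map ht hw he]

theorem hasShiftDensity_stdGaussian {D : ℕ} (δ : Vec D) :
    ∃ ℓ, HasShiftDensity (stdGaussian (Vec D)) δ ℓ (‖δ‖ ^ 2) := by
  have h := HasShiftDensity.pi fun i : Fin D => hasShiftDensity_gaussianReal (δ i)
  have hm : Measurable (WithLp.toLp 2 : (Fin D → ℝ) → Vec D) := by fun_prop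
  refine ⟨fun x => ∑ i, δ i * x i, by fun_prop, fun x => by simp, ?_, ?_⟩
  · rw [← map_pi_eq_stdGaussian, Measure.map_map (by fun_prop) hm]
    conv_rhs => rw [← h.symm, Measure.map_map hm (by fun_prop)]
    rfl
  · rw [← map_pi_eq_stdGaussian, Measure.map_map (by fun_prop) hm,
      ← map_withDensity_comp hm _ (by fun_prop), EuclideanSpace.real_norm_sq_eq]
    refine Eq.trans ?_ (congrArg (Measure.map (WithLp.toLp 2)) h.shift)
    rw [Measure.map_map hm (by fun_prop)]
    rfl

/-- Two-point testing bound for a translate: if `F + G ≥ Δ`, the mean of `F` under `ν` and the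
mean of `G` under the translate of `ν` cannot both be small. -/
theorem HasShiftDensity.le_lintegral_add {E : Type*} [MeasurableSpace E] [AddCommGroup E]
    [MeasurableAdd E] [MeasurableNeg E] {ν : Measure E} [IsProbabilityMeasure ν] {δ : E}
    {ℓ : E → ℝ} {s : ℝ} (h : HasShiftDensity ν δ ℓ s) (hs : 0 ≤ s) {F G : E → ℝ≥0∞}
    (hF : Measurable F) (hG : Measurable G) {Δ : ℝ≥0∞} (hFG : ∀ x, Δ ≤ F x + G x) :
    Δ / 2 * ENNReal.ofReal (Real.exp (-s / 2)) ≤ ∫⁻ x, F x ∂ν + ∫⁻ x, G (x + δ) ∂ν := by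
  have hℓ := h.measurable
  set w : E → ℝ≥0∞ := fun x => ENNReal.ofReal (Real.exp (ℓ x - s / 2)) with hw
  have hwm : Measurable w := by fun_prop
  have hmin : Measurable fun x => min 1 (w x) := by fun_prop
  have hshift : ∫⁻ x, G (x + δ) ∂ν = ∫⁻ x, w x * G x ∂ν := by
    rw [← lintegral_map hG (measurable_add_const δ), h.shift,
      lintegral_withDensity_eq_lintegral_mul _ hwm hG]
    rfl
  have hsymm : ∫⁻ x, min 1 (w (-x)) ∂ν = ∫⁻ x, min 1 (w x) ∂ν := by
    conv_rhs => rw [← h.symm, lintegral_map hmin measurable_neg]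
  -- Oddness of `ℓ` and symmetry of `ν` replace a divergence inequality: `ℓ` is nonnegative at one
  -- of `x`, `-x`, and there the density `w` is at least `exp (-s / 2)`.
  have hone : ENNReal.ofReal (Real.exp (-s / 2)) ≤ 2 * ∫⁻ x, min 1 (w x) ∂ν := by
    calc ENNReal.ofReal (Real.exp (-s / 2))
        = ∫⁻ _, ENNReal.ofReal (Real.exp (-s / 2)) ∂ν := by simp
      _ ≤ ∫⁻ x, (min 1 (w x) + min 1 (w (-x))) ∂ν := by
          refine lintegral_mono fun x => ?_
          have key : ∀ y, 0 ≤ ℓ y → ENNReal.ofReal (Real.exp (-s / 2)) ≤ min 1 (w y) := by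
            intro y hy
            refine le_min ?_ (ENNReal.ofReal_le_ofReal (Real.exp_le_exp.2 (by linarith)))
            rw [← ENNReal.ofReal_one]
            exact ENNReal.ofReal_le_ofReal (Real.exp_le_one_iff.2 (by linarith))
          rcases le_total 0 (ℓ x) with hx | hx
          · exact (key x hx).trans le_self_add
          · exact (key (-x) (by rw [h.odd]; linarith)).trans le_add_self
      _ = 2 * ∫⁻ x, min 1 (w x) ∂ν := by rw [lintegral_add_left hmin, hsymm, two_mul]
  calc Δ / 2 * ENNReal.ofReal (Real.exp (-s / 2))
      ≤ Δ / 2 * (2 * ∫⁻ x, min 1 (w x) ∂ν) := by gcongr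
    _ = Δ * ∫⁻ x, min 1 (w x) ∂ν := by
        rw [← mul_assoc, ENNReal.div_mul_cancel two_ne_zero ENNReal.ofNat_ne_top]
    _ = ∫⁻ x, Δ * min 1 (w x) ∂ν := (lintegral_const_mul _ hmin).symm
    _ ≤ ∫⁻ x, (F x + w x * G x) ∂ν := by
        refine lintegral_mono fun x => ?_
        calc Δ * min 1 (w x) ≤ (F x + G x) * min 1 (w x) := by gcongr; exact hFG x
          _ = F x * min 1 (w x) + G x * min 1 (w x) := add_mul _ _ _
          _ ≤ F x * 1 + G x * w x := by
              gcongr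
              · exact min_le_left _ _
              · exact min_le_right _ _
          _ = F x + w x * G x := by rw [mul_one, mul_comm]
    _ = ∫⁻ x, F x ∂ν + ∫⁻ x, G (x + δ) ∂ν := by rw [lintegral_add_left hF, hshift]

/-! ### Le Cam's bound for the regression model -/

/-- The law of the noise variables. -/
noncomputable abbrev noiseLaw (D n m : ℕ) : Measure (Fin n → Fin m → Vec D) :=
  Measure.pi fun _ => Measure.pi fun _ => stdGaussian (Vec D)

theorem hasShiftDensity_noiseLaw {D n m : ℕ} (δ : Fin n → Fin m → Vec D) :
    ∃ ℓ, HasShiftDensity (noiseLaw D n m) δ ℓ (∑ i, ∑ j, ‖δ i j‖ ^ 2) := by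
  choose ℓ hℓ using fun i j => hasShiftDensity_stdGaussian (δ i j)
  exact ⟨_, HasShiftDensity.pi fun i => HasShiftDensity.pi fun j => hℓ i j⟩

/-- Grönwall's inequality. It serves to make the observations measurable functions of the initial
values. -/
theorem lipschitzWith_flow {D : ℕ} {L M : ℝ} {f : Vec D → Vec D} (hf : f ∈ Lip D L M) {t : ℝ}
    (ht : 0 ≤ t) : LipschitzWith (Real.exp (L.toNNReal * t)).toNNReal fun x => flow f x t := by
  refine LipschitzWith.of_dist_le_mul fun x y => ?_
  have hx := isSolution_flow hf x
  have hy := isSolution_flow hf y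
  have h := dist_le_of_trajectories_ODE (v := fun _ => f) (K := L.toNNReal) (a := 0) (b := t)
    (f := flow f x) (g := flow f y) (δ := dist x y) (fun _ => Lip.lipschitzWith hf)
    (fun s _ => (hx.2 s).continuousAt.continuousWithinAt)
    (fun s _ => (hx.2 s).hasDerivWithinAt)
    (fun s _ => (hy.2 s).continuousAt.continuousWithinAt)
    (fun s _ => (hy.2 s).hasDerivWithinAt) (by rw [hx.1, hy.1]) t ⟨ht, le_rfl⟩
  rwa [sub_zero, mul_comm, ← Real.coe_toNNReal _ (Real.exp_pos _).le] at h

theorem gridTime_nonneg {T : ℝ} (hT : 0 ≤ T) (m : ℕ) (j : Fin m) : 0 ≤ gridTime T m j := by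
  unfold gridTime; positivity

theorem measurable_flow_gridTime {D : ℕ} {L M T : ℝ} {f : Vec D → Vec D} (hf : f ∈ Lip D L M)
    (hT : 0 ≤ T) (m : ℕ) (j : Fin m) : Measurable fun x => flow f x (gridTime T m j) :=
  (lipschitzWith_flow hf (gridTime_nonneg hT m j)).continuous.measurable

theorem measurable_observe {D n m : ℕ} {L M T : ℝ} {f : Vec D → Vec D} (hf : f ∈ Lip D L M)
    (hT : 0 ≤ T) (σ : ℝ) : Measurable (observe (n := n) (m := m) f T σ) := by
  refine measurable_fst.prodMk (measurable_pi_lambda _ fun i => measurable_pi_lambda _ fun j => ?_)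
  have h1 : Measurable fun ω : (Fin n → Vec D) × (Fin n → Fin m → Vec D) =>
      flow f (ω.1 i) (gridTime T m j) :=
    (measurable_flow_gridTime hf hT m j).comp ((measurable_pi_apply i).comp measurable_fst)
  have h2 : Measurable fun ω : (Fin n → Vec D) × (Fin n → Fin m → Vec D) => ω.2 i j :=
    (measurable_pi_apply j).comp ((measurable_pi_apply i).comp measurable_snd)
  exact h1.add (h2.const_smul σ)

/-- The squared distance of the trajectories of `f` and `g` from `z`, in units of the noise level,
summed over the grid. -/
noncomputable def separation {D : ℕ} (f g : Vec D → Vec D) (T σ : ℝ) (m : ℕ) (z : Vec D) : ℝ :=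
  ∑ j : Fin m, ‖σ⁻¹ • (flow g z (gridTime T m j) - flow f z (gridTime T m j))‖ ^ 2

/-- Le Cam's two-point bound. -/
theorem two_point_bound {D n m : ℕ} {L M T σ : ℝ} {f g : Vec D → Vec D} (hf : f ∈ Lip D L M)
    (hg : g ∈ Lip D L M) (μ : Measure (Vec D)) [IsProbabilityMeasure μ] (hT : 0 ≤ T)
    (hσ : σ ≠ 0) {fhat : Data D n m → Vec D → Vec D} (hfhat : fhat ∈ estimators D n m)
    (x : Vec D) :
    ‖f x - g x‖ₑ / 2 *
        (∫⁻ z, ENNReal.ofReal (Real.exp (-separation f g T σ m z / 2)) ∂μ) ^ n ≤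
      risk fhat f μ T σ x + risk fhat g μ T σ x := by
  have hsep : Measurable (separation f g T σ m) :=
    Finset.measurable_sum _ fun j _ =>
      (((measurable_flow_gridTime hg hT m j).sub
        (measurable_flow_gridTime hf hT m j)).const_smul σ⁻¹).norm.pow_const 2
  have hk : Measurable fun z => ENNReal.ofReal (Real.exp (-separation f g T σ m z / 2)) := by
    fun_prop
  have hmeas : ∀ h : Vec D → Vec D, h ∈ Lip D L M → Measurable
      fun ω : (Fin n → Vec D) × (Fin n → Fin m → Vec D) => ‖fhat (observe h T σ ω) x - h x‖ₑ :=
    fun h hh => (((hfhat x).comp (measurable_observe hh hT σ)).sub_const _).enorm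
  -- The testing bound is applied with the initial values frozen; integrating over them afterwards
  -- factorizes into an `n`-th power.
  have hpoint : ∀ X : Fin n → Vec D,
      ‖f x - g x‖ₑ / 2 * ∏ i, ENNReal.ofReal (Real.exp (-separation f g T σ m (X i) / 2)) ≤
        ∫⁻ ε, ‖fhat (observe f T σ (X, ε)) x - f x‖ₑ ∂noiseLaw D n m +
          ∫⁻ ε, ‖fhat (observe g T σ (X, ε)) x - g x‖ₑ ∂noiseLaw D n m := by
    intro X
    obtain ⟨ℓ, hℓ⟩ := hasShiftDensity_noiseLaw (n := n) (m := m) fun i j =>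
      σ⁻¹ • (flow g (X i) (gridTime T m j) - flow f (X i) (gridTime T m j))
    have hobs : ∀ ε : Fin n → Fin m → Vec D, observe g T σ (X, ε) =
        observe f T σ (X, ε + fun i j =>
          σ⁻¹ • (flow g (X i) (gridTime T m j) - flow f (X i) (gridTime T m j))) := by
      intro ε
      refine Prod.ext rfl (funext fun i => funext fun j => ?_)
      simp only [observe, Pi.add_apply, smul_add, smul_inv_smul₀ hσ]
      abel
    have hm1 : Measurable fun ε : Fin n → Fin m → Vec D =>
        ‖fhat (observe f T σ (X, ε)) x - f x‖ₑ := (hmeas f hf).comp measurable_prodMk_left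
    have hm2 : Measurable fun ε : Fin n → Fin m → Vec D =>
        ‖fhat (observe f T σ (X, ε)) x - g x‖ₑ :=
      (((hfhat x).comp ((measurable_observe hf hT σ).comp measurable_prodMk_left)).sub_const
        _).enorm
    have h := hℓ.le_lintegral_add (by positivity) hm1 hm2 (Δ := ‖f x - g x‖ₑ) fun ε => by
      rw [← edist_eq_enorm_sub, ← edist_eq_enorm_sub, ← edist_eq_enorm_sub, edist_comm _ (f x)]
      exact edist_triangle _ _ _
    simp only [hobs]
    refine le_trans (le_of_eq ?_) h
    rw [← ENNReal.ofReal_prod_of_nonneg fun i _ => (Real.exp_pos _).le, ← Real.exp_sum,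
      ← Finset.sum_div, Finset.sum_neg_distrib]
    rfl
  have hprod : ∫⁻ X : Fin n → Vec D,
      ∏ i, ENNReal.ofReal (Real.exp (-separation f g T σ m (X i) / 2)) ∂Measure.pi (fun _ => μ) =
      (∫⁻ z, ENNReal.ofReal (Real.exp (-separation f g T σ m z / 2)) ∂μ) ^ n := by
    rw [lintegral_pi_prod (fun _ : Fin n => μ) fun _ => hk]
    simp
  rw [risk, risk, sampleLaw, lintegral_prod _ (hmeas f hf).aemeasurable,
    lintegral_prod _ (hmeas g hg).aemeasurable,
    ← lintegral_add_left (hmeas f hf).lintegral_prod_right', ← hprod,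
    ← lintegral_const_mul _ (by fun_prop)]
  exact lintegral_mono hpoint

/-- Le Cam's lower bound for the minimax risk. -/
theorem le_minimaxRisk {D n m : ℕ} {L M a b T σ : ℝ} {f g : Vec D → Vec D} (hf : f ∈ Lip D L M)
    (hg : g ∈ Lip D L M) {μ : Measure (Vec D)} (hμ : μ ∈ Standard D a b) (hT : 0 ≤ T)
    (hσ : σ ≠ 0) {x : Vec D} (hxf : x ∈ Env f μ.support T) (hxg : x ∈ Env g μ.support T) :
    ‖f x - g x‖ₑ / 4 *
        (∫⁻ z, ENNReal.ofReal (Real.exp (-separation f g T σ m z / 2)) ∂μ) ^ n ≤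
      minimaxRisk D n m L M a b T σ := by
  have := hμ.1
  refine le_iInf₂ fun fhat hfhat => ?_
  have h := two_point_bound hf hg μ hT hσ hfhat x (m := m)
  set S := ⨆ f ∈ Lip D L M, ⨆ μ ∈ Standard D a b, ⨆ x ∈ Env f μ.support T, risk fhat f μ T σ x
  have hle : ∀ h ∈ Lip D L M, x ∈ Env h μ.support T → risk fhat h μ T σ x ≤ S := fun h hh hx =>
    le_trans (le_trans (le_iSup₂ (f := fun x (_ : x ∈ Env h μ.support T) =>
      risk fhat h μ T σ x) x hx) (le_iSup₂ (f := fun μ (_ : μ ∈ Standard D a b) =>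
        ⨆ x ∈ Env h μ.support T, risk fhat h μ T σ x) μ hμ))
      (le_iSup₂ (f := fun f (_ : f ∈ Lip D L M) => ⨆ μ ∈ Standard D a b,
        ⨆ x ∈ Env f μ.support T, risk fhat f μ T σ x) h hh)
  have h2 := h.trans (add_le_add (hle f hf hxf) (hle g hg hxg))
  rw [← two_mul] at h2
  -- The second factor `1/2`: the supremum `S` dominates both risks, hence their average.
  have h4 : ‖f x - g x‖ₑ / 4 = 2⁻¹ * (‖f x - g x‖ₑ / 2) := by
    rw [div_eq_mul_inv, div_eq_mul_inv, mul_left_comm, ← ENNReal.mul_inv (by simp) (by simp)]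
    norm_num
  rw [h4, mul_assoc]
  calc _ ≤ 2⁻¹ * (2 * S) := by gcongr
    _ = S := by rw [← mul_assoc, ENNReal.inv_mul_cancel two_ne_zero ENNReal.ofNat_ne_top, one_mul]

/-! ### The bump and its derivative -/

/-- A `C^1` function supported on `[0, r]`. -/
noncomputable def hump (r s : ℝ) : ℝ := max 0 (s * (r - s)) ^ 2

/-- The derivative of `hump r`. -/
noncomputable def humpDeriv (r s : ℝ) : ℝ := 2 * max 0 (s * (r - s)) * (r - 2 * s)

theorem hasDerivAt_max_zero_sq (u : ℝ) :
    HasDerivAt (fun u : ℝ => max 0 u ^ 2) (2 * max 0 u) u := by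
  rcases lt_trichotomy u 0 with hu | rfl | hu
  · rw [max_eq_left hu.le, mul_zero]
    refine (hasDerivAt_const u (0 : ℝ)).congr_of_eventuallyEq ?_
    filter_upwards [Iio_mem_nhds hu] with w hw
    rw [max_eq_left (le_of_lt hw)]; norm_num
  · rw [max_self, mul_zero, hasDerivAt_iff_isLittleO_nhds_zero]
    have h : (fun h : ℝ => h ^ 2) =o[nhds 0] fun h => h := by
      simpa using Asymptotics.isLittleO_pow_pow (𝕜 := ℝ) (m := 1) (n := 2) (by norm_num)
    refine (Asymptotics.IsBigO.of_bound 1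
      (Filter.Eventually.of_forall fun x => ?_)).trans_isLittleO h
    rcases le_total x 0 with hx | hx
    · simp [max_eq_left hx, sq_nonneg]
    · simp [max_eq_right hx]
  · rw [max_eq_right hu.le]
    have h := hasDerivAt_pow 2 u
    norm_num at h
    refine h.congr_of_eventuallyEq ?_
    filter_upwards [Ioi_mem_nhds hu] with w hw
    rw [max_eq_right (le_of_lt hw)]

theorem hasDerivAt_hump (r s : ℝ) : HasDerivAt (hump r) (humpDeriv r s) s := by
  have h1 : HasDerivAt (fun s : ℝ => s * (r - s)) (r - 2 * s) s := by
    have := (hasDerivAt_id s).mul ((hasDerivAt_id s).const_sub r)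
    refine this.congr_deriv ?_
    simp; ring
  exact (hasDerivAt_max_zero_sq (s * (r - s))).comp s h1

theorem hump_nonneg (r s : ℝ) : 0 ≤ hump r s := sq_nonneg _

theorem hump_eq_zero {r s : ℝ} (h : s * (r - s) ≤ 0) : hump r s = 0 := by
  rw [hump, max_eq_left h]; norm_num

theorem hump_le (r s : ℝ) : hump r s ≤ r ^ 4 / 16 := by
  have h : max 0 (s * (r - s)) ≤ r ^ 2 / 4 :=
    max_le (by positivity) (by nlinarith [sq_nonneg (r - 2 * s)])
  calc hump r s ≤ (r ^ 2 / 4) ^ 2 := pow_le_pow_left₀ (le_max_left _ _) h 2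
    _ = r ^ 4 / 16 := by ring

/-- The cubic `2 u (r - u) (r - 2 u)` vanishes at `0` and `r`, so it may be evaluated at `s` clamped
to `[0, r]`. Clamping is 1-Lipschitz, which reduces bounds for `humpDeriv` to polynomial
inequalities on `[0, r]`. -/
theorem humpDeriv_eq_clamp {r : ℝ} (hr : 0 < r) (s : ℝ) :
    humpDeriv r s = 2 * max 0 (min s r) * (r - max 0 (min s r)) * (r - 2 * max 0 (min s r)) := by
  unfold humpDeriv
  rcases le_total s 0 with hs | hs
  · rw [max_eq_left (by nlinarith : s * (r - s) ≤ 0), min_eq_left (by linarith), max_eq_left hs]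
    ring
  rcases le_total s r with hsr | hsr
  · rw [max_eq_right (by nlinarith : 0 ≤ s * (r - s)), min_eq_left hsr, max_eq_right hs]
    ring
  · rw [max_eq_left (by nlinarith : s * (r - s) ≤ 0), min_eq_right hsr, max_eq_right hr.le]
    ring

theorem abs_humpDeriv_le {r : ℝ} (hr : 0 < r) (s : ℝ) : |humpDeriv r s| ≤ r ^ 3 / 2 := by
  rw [humpDeriv_eq_clamp hr]
  set u := max 0 (min s r)
  have h0 : 0 ≤ u := le_max_left _ _
  have h1 : u ≤ r := max_le hr.le (min_le_right _ _)
  have h2 : |2 * u * (r - u)| ≤ r ^ 2 / 2 := by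
    rw [abs_of_nonneg (mul_nonneg (by linarith) (by linarith))]
    nlinarith [sq_nonneg (r - 2 * u)]
  have h3 : |r - 2 * u| ≤ r := abs_le.2 ⟨by linarith, by linarith⟩
  rw [abs_mul]
  calc _ ≤ r ^ 2 / 2 * r := mul_le_mul h2 h3 (abs_nonneg _) (by positivity)
    _ = r ^ 3 / 2 := by ring

theorem abs_humpDeriv_sub_le {r : ℝ} (hr : 0 < r) (s t : ℝ) :
    |humpDeriv r s - humpDeriv r t| ≤ 14 * r ^ 2 * |s - t| := by
  rw [humpDeriv_eq_clamp hr, humpDeriv_eq_clamp hr]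
  have hst : |max 0 (min s r) - max 0 (min t r)| ≤ |s - t| := by
    rw [max_comm 0, max_comm 0]
    exact (abs_max_sub_max_le_abs _ _ _).trans ((abs_min_sub_min_le_max s r t r).trans (by simp))
  set u := max 0 (min s r)
  set w := max 0 (min t r)
  have hu0 : 0 ≤ u := le_max_left _ _
  have hu1 : u ≤ r := max_le hr.le (min_le_right _ _)
  have hw0 : 0 ≤ w := le_max_left _ _
  have hw1 : w ≤ r := max_le hr.le (min_le_right _ _)
  have hid : 2 * u * (r - u) * (r - 2 * u) - 2 * w * (r - w) * (r - 2 * w) =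
      2 * (r ^ 2 - 3 * r * (u + w) + 2 * (u ^ 2 + u * w + w ^ 2)) * (u - w) := by ring
  rw [hid, abs_mul]
  refine mul_le_mul ?_ hst (abs_nonneg _) (by positivity)
  rw [abs_le]
  constructor <;> nlinarith [mul_nonneg hu0 hw0, mul_nonneg hu0 (sub_nonneg.2 hu1),
    mul_nonneg hw0 (sub_nonneg.2 hw1), mul_nonneg hu0 (sub_nonneg.2 hw1), mul_nonneg hr.le hu0,
    mul_nonneg hr.le hw0, mul_nonneg hr.le (sub_nonneg.2 hu1), mul_nonneg hr.le (sub_nonneg.2 hw1)]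

/-! ### Slab fields and their flows -/

/-- The vector field pointing in the direction of the `i`-th axis, whose speed `v` is perturbed
for `0 < x i < r` so that the travel time through this slab is not changed. -/
noncomputable def slabField {D : ℕ} (i : Fin D) (v c r : ℝ) (x : Vec D) : Vec D :=
  EuclideanSpace.single i (v / (1 + c * humpDeriv r (x i)))

theorem single_eq_smul {D : ℕ} (i : Fin D) (s : ℝ) :
    (EuclideanSpace.single i s : Vec D) = s • EuclideanSpace.single i (1 : ℝ) := by
  ext j; simp [PiLp.single_apply]

theorem abs_mul_humpDeriv_le {c r : ℝ} (hr : 0 < r) (hr1 : r ≤ 1) (hc : 0 ≤ c)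
    (hcr : c * r ^ 2 ≤ 1) (s : ℝ) : |c * humpDeriv r s| ≤ 1 / 2 := by
  rw [abs_mul, abs_of_nonneg hc]
  calc c * |humpDeriv r s| ≤ c * (r ^ 3 / 2) :=
        mul_le_mul_of_nonneg_left (abs_humpDeriv_le hr s) hc
    _ = (c * r ^ 2) * r / 2 := by ring
    _ ≤ 1 * 1 / 2 := by
        have := mul_le_mul hcr hr1 hr.le zero_le_one
        linarith
    _ = 1 / 2 := by norm_num

theorem slabField_mem_Lip {D : ℕ} (i : Fin D) {v c r L M : ℝ} (hr : 0 < r) (hr1 : r ≤ 1)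
    (hc : 0 ≤ c) (hcr : c * r ^ 2 ≤ 1) (hv : 0 ≤ v) (hL : 56 * v * (c * r ^ 2) ≤ L)
    (hM : 2 * v ≤ M) : slabField i v c r ∈ Lip D L M := by
  have hlow : ∀ s, 1 / 2 ≤ 1 + c * humpDeriv r s := fun s => by
    have := (abs_le.1 (abs_mul_humpDeriv_le hr hr1 hc hcr s)).1
    linarith
  refine ⟨fun x y => ?_, fun x => ?_⟩
  · rw [slabField, slabField, ← dist_eq_norm, PiLp.dist_single_same, Real.dist_eq]
    set A := 1 + c * humpDeriv r (x i)
    set B := 1 + c * humpDeriv r (y i)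
    have hA : 1 / 2 ≤ A := hlow _
    have hB : 1 / 2 ≤ B := hlow _
    have hAB : |B - A| ≤ 14 * (c * r ^ 2) * ‖x - y‖ := by
      have h1 : B - A = c * (humpDeriv r (y i) - humpDeriv r (x i)) := by
        simp only [A, B]; ring
      have h2 : |y i - x i| ≤ ‖x - y‖ := by
        have := PiLp.norm_apply_le (x - y) i
        rwa [PiLp.sub_apply, Real.norm_eq_abs, abs_sub_comm] at this
      rw [h1, abs_mul, abs_of_nonneg hc]
      calc _ ≤ c * (14 * r ^ 2 * ‖x - y‖) := by
            gcongr
            exact (abs_humpDeriv_sub_le hr _ _).trans (by gcongr)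
        _ = _ := by ring
    have hdiff : v / A - v / B = v * (B - A) / (A * B) := by
      field_simp
    rw [hdiff, abs_div, abs_mul, abs_of_nonneg hv, abs_of_pos (by positivity : 0 < A * B),
      div_le_iff₀ (by positivity)]
    -- The constant `56` is `4 * 14`: `4` bounds `1 / (A * B)`, and `14` comes from the Lipschitz
    -- bound on `humpDeriv`.
    have hABlow : 1 / 4 ≤ A * B := by nlinarith
    calc v * |B - A| ≤ v * (14 * (c * r ^ 2) * ‖x - y‖) := by gcongr
      _ = 56 * v * (c * r ^ 2) * ‖x - y‖ * (1 / 4) := by ring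
      _ ≤ L * ‖x - y‖ * (A * B) := by
          have hL0 : 0 ≤ L := le_trans (by positivity) hL
          gcongr
  · have := hlow (x i)
    rw [slabField, PiLp.norm_single, Real.norm_eq_abs, abs_of_nonneg (by positivity),
      div_le_iff₀ (by linarith)]
    nlinarith

section Flow

variable {D : ℕ} {i : Fin D} {v c r L M : ℝ}

/-- Multiplying the equation for the `i`-th coordinate by `1 + c h'` gives `(y i + c h (y i))' = v`.
This first integral determines the trajectory up to an implicit equation for `y i`. -/
theorem flow_slabField (hr : 0 < r) (hr1 : r ≤ 1) (hc : 0 ≤ c) (hcr : c * r ^ 2 ≤ 1)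
    (hf : slabField i v c r ∈ Lip D L M) (x : Vec D) (t : ℝ) :
    flow (slabField i v c r) x t = x + EuclideanSpace.single i
      (v * t - c * hump r (flow (slabField i v c r) x t i) + c * hump r (x i)) := by
  obtain ⟨h0, hy⟩ := isSolution_flow hf x
  set y := flow (slabField i v c r) x
  set e : Vec D := EuclideanSpace.single i 1
  have hyi : ∀ t, HasDerivAt (fun t => y t i) (v / (1 + c * humpDeriv r (y t i))) t := fun t => by
    have := (EuclideanSpace.proj (𝕜 := ℝ) i).hasFDerivAt.comp_hasDerivAt t (hy t)
    refine this.congr_deriv ?_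
    simp [slabField]
  have hF : ∀ t, HasDerivAt (fun t => y t + (c * hump r (y t i) - v * t) • e) 0 t := fun t => by
    have h1 := ((hasDerivAt_hump r (y t i)).comp t (hyi t)).const_mul c
    have h2 := (hasDerivAt_id t).const_mul v
    have h3 := (hy t).add ((h1.sub h2).smul_const e)
    refine h3.congr_deriv ?_
    rw [slabField, single_eq_smul, ← add_smul]
    have hpos : 1 + c * humpDeriv r (y t i) ≠ 0 := by
      have := (abs_le.1 (abs_mul_humpDeriv_le hr hr1 hc hcr (y t i))).1
      linarith
    have : v / (1 + c * humpDeriv r (y t i)) +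
        (c * (humpDeriv r (y t i) * (v / (1 + c * humpDeriv r (y t i)))) - v * 1) = 0 := by
      field_simp; ring
    rw [this, zero_smul]
  have hconst := is_const_of_deriv_eq_zero (fun t => (hF t).differentiableAt)
    (fun t => (hF t).deriv) t 0
  simp only [h0, mul_zero, sub_zero] at hconst
  refine (eq_sub_of_add_eq hconst).trans ?_
  rw [single_eq_smul, show EuclideanSpace.single i (1 : ℝ) = e from rfl, sub_smul, add_smul,
    sub_smul]
  abel

theorem flow_slabField_of_le (hr : 0 < r) (hr1 : r < 1) (hc : 0 ≤ c) (hcr : c * r ^ 2 ≤ 1)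
    (hf : slabField i v c r ∈ Lip D L M) {x : Vec D} (hx : hump r (x i) = 0) {t : ℝ}
    (ht : r ≤ x i + v * t) :
    flow (slabField i v c r) x t = x + EuclideanSpace.single i (v * t) := by
  have h := flow_slabField hr hr1.le hc hcr hf x t
  have hi := congrArg (fun z : Vec D => z i) h
  set z := flow (slabField i v c r) x t i
  simp only [hx, PiLp.add_apply, PiLp.single_apply, if_true, mul_zero, add_zero] at hi
  have hz : hump r z = 0 := by
    -- Here `z + c h(z) = x i + v t ≥ r`. For `z` inside the slab, `c h(z) ≤ r (r - z) < r - z`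
    -- because `r < 1`, a contradiction.
    refine hump_eq_zero ?_
    by_contra hcon
    push Not at hcon
    have hz0 : 0 < z := by
      by_contra h'
      push Not at h'
      nlinarith
    have hzr : z < r := by
      by_contra h'
      push Not at h'
      nlinarith
    have h1 : c * hump r z ≤ r * (r - z) := by
      rw [hump, max_eq_right hcon.le]
      calc c * (z * (r - z)) ^ 2 = c * (z ^ 2 * ((r - z) * (r - z))) := by ring
        _ ≤ c * (r ^ 2 * (r * (r - z))) := by
            have : 0 ≤ r - z := by linarith
            gcongr
            linarith
        _ = (c * r ^ 2) * (r * (r - z)) := by ring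
        _ ≤ 1 * (r * (r - z)) := by
            gcongr
        _ = _ := one_mul _
    nlinarith
  rw [h, hz, hx, mul_zero, sub_zero, add_zero]

/-- The trajectory from `0` stays on the axis and has crossed the slab by time `T`, so by the
intermediate value theorem it visits the point. The same test point is therefore admissible for both
fields. -/
theorem mem_Env_slabField (hr : 0 < r) (hr1 : r < 1) (hc : 0 ≤ c) (hcr : c * r ^ 2 ≤ 1)
    (hf : slabField i v c r ∈ Lip D L M) {T : ℝ} (hT : 0 ≤ T) (hvT : r ≤ v * T) {𝒳 : Set (Vec D)}
    (h0 : 0 ∈ 𝒳) {s : ℝ} (hs : s ∈ Set.Icc 0 r) :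
    EuclideanSpace.single i s ∈ Env (slabField i v c r) 𝒳 T := by
  obtain ⟨hy0, hy⟩ := isSolution_flow hf 0
  have hcont : Continuous fun t => flow (slabField i v c r) 0 t i := by
    have : Continuous (flow (slabField i v c r) 0) :=
      continuous_iff_continuousAt.2 fun t => (hy t).continuousAt
    fun_prop
  have hT' := flow_slabField_of_le (x := 0) hr hr1 hc hcr hf (hump_eq_zero (by simp))
    (t := T) (by simpa using hvT)
  obtain ⟨t, ht, hts⟩ := intermediate_value_Icc hT hcont.continuousOn
    (show s ∈ _ from by
      simp only [hy0, hT']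
      simpa using ⟨hs.1, hs.2.trans hvT⟩)
  refine ⟨0, h0, t, ht, ?_⟩
  have h := flow_slabField hr hr1.le hc hcr hf 0 t
  have hi := congrArg (fun z : Vec D => z i) h
  simp only [PiLp.single_apply, if_true, PiLp.zero_apply, zero_add] at hi
  rw [h, zero_add, PiLp.zero_apply, ← hi]
  exact congrArg _ hts

theorem norm_flow_slabField_sub_le (hr : 0 < r) (hr1 : r < 1) (hc : 0 ≤ c) (hcr : c * r ^ 2 ≤ 1)
    (h₀ : slabField i v 0 r ∈ Lip D L M) (hf : slabField i v c r ∈ Lip D L M) (t : ℝ) :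
    ‖flow (slabField i v c r) 0 t - flow (slabField i v 0 r) 0 t‖ ≤ r ^ 2 := by
  rw [flow_slabField hr hr1.le hc hcr hf, flow_slabField hr hr1.le le_rfl (by simp) h₀,
    ← dist_eq_norm, dist_add_left, PiLp.dist_single_same, Real.dist_eq]
  have h0 : hump r ((0 : Vec D) i) = 0 := hump_eq_zero (by simp)
  set z := flow (slabField i v c r) 0 t i
  rw [h0]
  have h1 := mul_le_mul_of_nonneg_left (hump_le r z) hc
  have h2 := mul_nonneg hc (hump_nonneg r z)
  have h3 : c * (r ^ 4 / 16) = (c * r ^ 2) * r ^ 2 / 16 := by ring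
  have h4 : (c * r ^ 2) * r ^ 2 ≤ 1 * r ^ 2 := by gcongr
  rw [abs_le]
  constructor <;> nlinarith [sq_nonneg r]

end Flow

/-! ### Information carried by one trajectory -/

theorem card_filter_lt_le (m : ℕ) {w : ℝ} (hw : 0 ≤ w) :
    ((Finset.univ.filter fun j : Fin m => ((j : ℝ) + 1) < w).card : ℝ) ≤ w := by
  refine le_trans ?_ (Nat.floor_le hw)
  rw [Nat.cast_le]
  have h : ∀ j ∈ Finset.univ.filter (fun j : Fin m => ((j : ℝ) + 1) < w),
      (j : ℕ) ∈ Finset.range ⌊w⌋₊ := by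
    intro j hj
    rw [Finset.mem_range]
    have := (Finset.mem_filter.1 hj).2
    exact Nat.le_floor (by push_cast; exact this.le)
  simpa using Finset.card_le_card_of_injOn (fun j : Fin m => (j : ℕ)) h
    (Fin.val_injective.injOn)

section Separation

variable {D : ℕ} {i : Fin D} {v c r L M : ℝ}

theorem separation_nonneg (f g : Vec D → Vec D) (T σ : ℝ) (m : ℕ) (z : Vec D) :
    0 ≤ separation f g T σ m z := Finset.sum_nonneg fun _ _ => sq_nonneg _

theorem separation_slabField_eq_zero (hr : 0 < r) (hr1 : r < 1) (hc : 0 ≤ c)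
    (hcr : c * r ^ 2 ≤ 1) (h₀ : slabField i v 0 r ∈ Lip D L M)
    (hf : slabField i v c r ∈ Lip D L M) {T σ : ℝ} {m : ℕ} {x : Vec D}
    (hx : hump r (x i) = 0) (h : ∀ j, r ≤ x i + v * gridTime T m j) :
    separation (slabField i v 0 r) (slabField i v c r) T σ m x = 0 := by
  refine Finset.sum_eq_zero fun j _ => ?_
  rw [flow_slabField_of_le hr hr1 hc hcr hf hx (h j),
    flow_slabField_of_le hr hr1 le_rfl (by simp) h₀ hx (h j)]
  simp

/-- Only grid times before the exit time `r / v` count, and each contributes at most `r⁴ / σ²`. -/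
theorem separation_slabField_zero_le (hr : 0 < r) (hr1 : r < 1) (hc : 0 ≤ c)
    (hcr : c * r ^ 2 ≤ 1) (h₀ : slabField i v 0 r ∈ Lip D L M)
    (hf : slabField i v c r ∈ Lip D L M) (hv : 0 < v) {T : ℝ} (hT : 0 < T) (σ : ℝ) {m : ℕ}
    (hm : 0 < m) :
    separation (slabField i v 0 r) (slabField i v c r) T σ m 0 ≤
      (σ ^ 2 * (v * T))⁻¹ * (m * r ^ 5) := by
  have hm' : (0 : ℝ) < m := by exact_mod_cast hm
  calc separation (slabField i v 0 r) (slabField i v c r) T σ m 0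
      ≤ ∑ j : Fin m, if ((j : ℝ) + 1) < m * r / (v * T) then (σ ^ 2)⁻¹ * r ^ 4 else 0 := by
        refine Finset.sum_le_sum fun j _ => ?_
        split_ifs with hj
        · rw [norm_smul, mul_pow, norm_inv, inv_pow, Real.norm_eq_abs, sq_abs]
          have := norm_flow_slabField_sub_le hr hr1 hc hcr h₀ hf (gridTime T m j)
          calc _ ≤ (σ ^ 2)⁻¹ * (r ^ 2) ^ 2 := by gcongr
            _ = _ := by ring
        · have ht : r ≤ (0 : Vec D) i + v * gridTime T m j := by
            rw [not_lt, div_le_iff₀ (by positivity)] at hj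
            rw [PiLp.zero_apply, zero_add, gridTime, ← mul_div_assoc, le_div_iff₀ hm']
            linarith
          have hx : hump r ((0 : Vec D) i) = 0 := hump_eq_zero (by simp)
          rw [flow_slabField_of_le hr hr1 hc hcr hf hx ht,
            flow_slabField_of_le hr hr1 le_rfl (by simp) h₀ hx ht]
          simp
    _ = ((Finset.univ.filter fun j : Fin m => ((j : ℝ) + 1) < m * r / (v * T)).card : ℝ) *
          ((σ ^ 2)⁻¹ * r ^ 4) := by
        rw [← Finset.sum_filter, Finset.sum_const, nsmul_eq_mul]
    _ ≤ m * r / (v * T) * ((σ ^ 2)⁻¹ * r ^ 4) := by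
        gcongr
        exact card_filter_lt_le m (by positivity)
    _ = (σ ^ 2 * (v * T))⁻¹ * (m * r ^ 5) := by rw [mul_inv]; ring

end Separation

/-- At the centre `r / 2` the derivative of the bump vanishes; at `r / 4` it is `3 r³ / 16`, of full
order. -/
theorem le_norm_slabField_sub {D : ℕ} (i : Fin D) {v c r : ℝ} (hr : 0 < r) (hr1 : r ≤ 1)
    (hc : 0 ≤ c) (hcr : c * r ^ 2 ≤ 1) (hv : 0 ≤ v) :
    v * (c * r ^ 2) * r / 8 ≤
      ‖slabField i v 0 r (EuclideanSpace.single i (r / 4)) -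
        slabField i v c r (EuclideanSpace.single i (r / 4))‖ := by
  have hd : humpDeriv r (r / 4) = 3 * r ^ 3 / 16 := by
    rw [humpDeriv, max_eq_right (by nlinarith)]; ring
  rw [slabField, slabField, ← dist_eq_norm, PiLp.dist_single_same, Real.dist_eq]
  simp only [PiLp.single_apply, if_true, hd, zero_mul, add_zero, div_one]
  have ha : c * (3 * r ^ 3 / 16) = 3 / 16 * (c * r ^ 2 * r) := by ring
  rw [ha]
  set k := c * r ^ 2 * r with hk
  have hk0 : 0 ≤ k := by positivity
  have hk1 : k ≤ 1 := by nlinarith [mul_nonneg hc (sq_nonneg r)]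
  refine le_trans ?_ (le_abs_self _)
  have : v - v / (1 + 3 / 16 * k) = v * (3 / 16 * k) / (1 + 3 / 16 * k) := by
    field_simp; ring
  rw [this, le_div_iff₀ (by positivity)]
  have h1 : v * (c * r ^ 2) * r / 8 = v * k / 8 := by rw [hk]; ring
  rw [h1]
  nlinarith [mul_nonneg hv hk0, mul_nonneg (mul_nonneg hv hk0) (sub_nonneg.2 hk1)]

/-! ### Two-atom initial laws -/

/-- The law with an atom of mass `p` at `0` and an atom of mass `1 - p` at distance `r` of it. -/
noncomputable def twoAtoms {D : ℕ} (i : Fin D) (p r : ℝ) : Measure (Vec D) :=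
  ENNReal.ofReal p • Measure.dirac 0 +
    ENNReal.ofReal (1 - p) • Measure.dirac (EuclideanSpace.single i r)

section TwoAtoms

variable {D : ℕ} {i : Fin D} {p r : ℝ}

theorem isProbabilityMeasure_twoAtoms (hp0 : 0 ≤ p) (hp1 : p ≤ 1) :
    IsProbabilityMeasure (twoAtoms i p r) := by
  refine ⟨?_⟩
  simp only [twoAtoms, Measure.add_apply, Measure.smul_apply, smul_eq_mul, measure_univ, mul_one]
  rw [← ENNReal.ofReal_add hp0 (by linarith)]
  simp

theorem zero_mem_support_twoAtoms (hp0 : 0 < p) : (0 : Vec D) ∈ (twoAtoms i p r).support := by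
  rw [Measure.mem_support_iff_forall]
  intro U hU
  have h0 : (0 : Vec D) ∈ U := mem_of_mem_nhds hU
  have h1 : ENNReal.ofReal p ≤ twoAtoms i p r U := by
    simp only [twoAtoms, Measure.add_apply, Measure.smul_apply, smul_eq_mul,
      Measure.dirac_apply_of_mem h0, mul_one]
    exact le_self_add
  exact (ENNReal.ofReal_pos.2 hp0).trans_le h1

theorem support_twoAtoms_subset :
    (twoAtoms i p r).support ⊆ {0, EuclideanSpace.single i r} := by
  refine Measure.support_subset_of_isClosed (Set.toFinite _).isClosed ?_
  rw [mem_ae_iff]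
  simp [twoAtoms]

theorem support_twoAtoms_one_subset : (twoAtoms i 1 r).support ⊆ {0} := by
  refine Measure.support_subset_of_isClosed (Set.toFinite _).isClosed ?_
  rw [mem_ae_iff]
  simp [twoAtoms]

theorem lintegral_twoAtoms (k : Vec D → ℝ≥0∞) :
    ∫⁻ z, k z ∂twoAtoms i p r =
      ENNReal.ofReal p * k 0 + ENNReal.ofReal (1 - p) * k (EuclideanSpace.single i r) := by
  simp [twoAtoms]

theorem twoAtoms_mem_Standard {a b : ℝ} (ha : 0 ≤ a) (hb : 0 ≤ b) (hr : 0 ≤ r) (hp0 : 0 ≤ p)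
    (hp : p = 1 ∨ p ≤ 1 / 2 ∧ a * r ^ b ≤ p) : twoAtoms i p r ∈ Standard D a b := by
  have hp1 : p ≤ 1 := by rcases hp with rfl | ⟨h, -⟩ <;> linarith
  refine ⟨isProbabilityMeasure_twoAtoms hp0 hp1, fun x hx R hR => ?_⟩
  have hprob : IsProbabilityMeasure (twoAtoms i p r) := isProbabilityMeasure_twoAtoms hp0 hp1
  rcases hp with rfl | ⟨hp2, hap⟩
  · obtain rfl := support_twoAtoms_one_subset hx
    have : (twoAtoms i 1 r : Measure (Vec D)) (Metric.closedBall 0 R) = 1 := by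
      simp [twoAtoms, hR.le]
    rw [this, ← ENNReal.ofReal_one]
    exact ENNReal.ofReal_le_ofReal (min_le_right _ _)
  · have hdist : dist (0 : Vec D) (EuclideanSpace.single i r) = r := by
      rw [dist_zero_left, PiLp.norm_single, Real.norm_eq_abs, abs_of_nonneg hr]
    have hx' : x = 0 ∨ x = EuclideanSpace.single i r := support_twoAtoms_subset hx
    have hball : x ∈ Metric.closedBall x R := Metric.mem_closedBall_self hR.le
    -- A ball of radius below `r` is only known to hold its own atom, of mass at least `p` as `p ≤
    -- 1/2`; a larger ball holds both.
    rcases lt_or_ge R r with hRr | hRr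
    · have hle : min (a * R ^ b) 1 ≤ p := by
        refine (min_le_left _ _).trans (le_trans ?_ hap)
        gcongr
      rcases hx' with rfl | rfl
      · refine (ENNReal.ofReal_le_ofReal hle).trans ?_
        simp only [twoAtoms, Measure.add_apply, Measure.smul_apply, smul_eq_mul,
          Measure.dirac_apply_of_mem hball, mul_one]
        exact le_self_add
      · refine (ENNReal.ofReal_le_ofReal (hle.trans (by linarith : p ≤ 1 - p))).trans ?_
        simp only [twoAtoms, Measure.add_apply, Measure.smul_apply, smul_eq_mul,
          Measure.dirac_apply_of_mem hball, mul_one]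
        exact le_add_self
    · have hsub : ({0, EuclideanSpace.single i r} : Set (Vec D)) ⊆ Metric.closedBall x R := by
        rcases hx' with rfl | rfl <;> rintro y (rfl | rfl) <;>
          simp only [Metric.mem_closedBall, dist_self, hdist, dist_comm _ (0 : Vec D)] <;> linarith
      have h1 : (0 : Vec D) ∈ Metric.closedBall x R := hsub (by simp)
      have h2 : EuclideanSpace.single i r ∈ Metric.closedBall x R := hsub (by simp)
      have : twoAtoms i p r (Metric.closedBall x R) = 1 := by
        rw [← hprob.measure_univ]
        simp only [twoAtoms, Measure.add_apply, Measure.smul_apply, smul_eq_mul,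
          Measure.dirac_apply_of_mem h1, Measure.dirac_apply_of_mem h2, measure_univ]
      rw [this, ← ENNReal.ofReal_one]
      exact ENNReal.ofReal_le_ofReal (min_le_right _ _)

end TwoAtoms

/-! ### The lower bound for given width and mass -/

/-- The lower bound on the minimax risk from a perturbation of width `r` of a constant field, for
initial values that meet the perturbation with probability `p`. -/
theorem exists_lower_bound {D : ℕ} (i : Fin D) {L M a b T σ : ℝ} (hL : 0 < L) (hM : 0 < M)
    (ha : 0 < a) (hb : 0 ≤ b) (hT : 0 < T) (hσ : 0 < σ) :
    ∃ c₀ > 0, ∃ r₀ > 0, ∃ C > 0, ∃ w > 0, ∀ r, 0 < r → r ≤ r₀ → ∀ p, 0 < p →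
      (p = 1 ∨ p ≤ 1 / 2 ∧ a * r ^ b ≤ p) → ∀ n m : ℕ, 0 < m →
      ∃ S, 0 ≤ S ∧ S ≤ C * (m * r ^ 5) ∧ (r ≤ w / m → S = 0) ∧
        ENNReal.ofReal (c₀ * r * (p * Real.exp (-S) + (1 - p)) ^ n) ≤
          minimaxRisk D n m L M a b T σ := by
  -- The perturbed speed is at most `2 v`, whence `M / 2`; `κ = c r²` is chosen so that the
  -- Lipschitz constant `56 v κ` is at most `L`.
  set v := M / 2 with hv
  have hv0 : 0 < v := by positivity
  set κ := min 1 (L / (56 * v)) with hκ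
  have hκ0 : 0 < κ := by positivity
  refine ⟨v * κ / 32, by positivity, min (1 / 2) (v * T), by positivity,
    (σ ^ 2 * (v * T))⁻¹ / 2, by positivity, v * T, by positivity, ?_⟩
  intro r hr hr₀ p hp0 hp n m hm
  have hp1 : p ≤ 1 := by rcases hp with rfl | ⟨h, -⟩ <;> linarith
  have hr1 : r < 1 := by linarith [hr₀.trans (min_le_left _ _)]
  have hrT : r ≤ v * T := hr₀.trans (min_le_right _ _)
  set c := κ / r ^ 2 with hc
  have hc0 : 0 ≤ c := by positivity
  have hck : c * r ^ 2 = κ := by rw [hc]; field_simp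
  have hcr : c * r ^ 2 ≤ 1 := hck ▸ min_le_left _ _
  have hf : slabField i v c r ∈ Lip D L M := by
    refine slabField_mem_Lip i hr hr1.le hc0 hcr hv0.le ?_ (by rw [hv]; linarith)
    rw [hck]
    calc 56 * v * κ ≤ 56 * v * (L / (56 * v)) := by gcongr; exact min_le_right _ _
      _ = L := by field_simp
  have h₀ : slabField i v 0 r ∈ Lip D L M :=
    slabField_mem_Lip i hr hr1.le le_rfl (by simp) hv0.le (by simpa using hL.le)
      (by rw [hv]; linarith)
  have hzero : hump r ((0 : Vec D) i) = 0 := hump_eq_zero (by simp)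
  have hμ : twoAtoms i p r ∈ Standard D a b := twoAtoms_mem_Standard ha.le hb hr.le hp0.le hp
  have hsupp : (0 : Vec D) ∈ (twoAtoms i p r).support := zero_mem_support_twoAtoms hp0
  have hmain := le_minimaxRisk (n := n) (m := m) h₀ hf hμ hT.le hσ.ne'
    (mem_Env_slabField hr hr1 le_rfl (by simp) h₀ hT.le hrT hsupp
      (s := r / 4) ⟨by positivity, by linarith⟩)
    (mem_Env_slabField hr hr1 hc0 hcr hf hT.le hrT hsupp
      (s := r / 4) ⟨by positivity, by linarith⟩)
  -- The second atom is already on the exit face `x i = r`.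
  have hsep : separation (slabField i v 0 r) (slabField i v c r) T σ m
      (EuclideanSpace.single i r) = 0 := by
    refine separation_slabField_eq_zero hr hr1 hc0 hcr h₀ hf (hump_eq_zero (by simp)) fun j => ?_
    have := mul_nonneg hv0.le (gridTime_nonneg hT.le m j)
    simpa using this
  have hdist := le_norm_slabField_sub i hr hr1.le hc0 hcr hv0.le
  rw [hck] at hdist
  refine ⟨separation (slabField i v 0 r) (slabField i v c r) T σ m 0 / 2,
    div_nonneg (separation_nonneg _ _ _ _ _ _) zero_le_two, ?_, ?_, ?_⟩
  · have := separation_slabField_zero_le hr hr1 hc0 hcr h₀ hf hv0 hT σ hm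
    linarith
  · intro hrm
    have hm' : (0 : ℝ) < m := by exact_mod_cast hm
    rw [separation_slabField_eq_zero hr hr1 hc0 hcr h₀ hf hzero, zero_div]
    intro j
    rw [PiLp.zero_apply, zero_add, gridTime, ← mul_div_assoc]
    refine hrm.trans ?_
    gcongr
    nlinarith [(Nat.cast_nonneg (j : ℕ) : (0 : ℝ) ≤ (j : ℕ))]
  · refine le_trans ?_ hmain
    rw [lintegral_twoAtoms, hsep, ← ENNReal.ofReal_mul hp0.le,
      ← ENNReal.ofReal_mul (by linarith : (0 : ℝ) ≤ 1 - p),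
      ← ENNReal.ofReal_add (by positivity) (mul_nonneg (by linarith) (Real.exp_pos _).le),
      ← ENNReal.ofReal_pow (add_nonneg (by positivity)
        (mul_nonneg (by linarith) (Real.exp_pos _).le)),
      ← ofReal_norm, ← ENNReal.ofReal_ofNat 4,
      ← ENNReal.ofReal_div_of_pos (by norm_num), ← ENNReal.ofReal_mul (by positivity)]
    refine ENNReal.ofReal_le_ofReal ?_
    rw [neg_zero, zero_div, Real.exp_zero, mul_one, neg_div]
    refine mul_le_mul_of_nonneg_right (by linarith) (pow_nonneg ?_ n)
    exact add_nonneg (by positivity) (by linarith)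

/-! ### Choice of the width and the mass -/

theorem exp_le_convex_pow {p S : ℝ} (hp0 : 0 ≤ p) (hp1 : p ≤ 1) (n : ℕ) :
    Real.exp (-(n * p * S)) ≤ (p * Real.exp (-S) + (1 - p)) ^ n := by
  have h := convexOn_exp.2 (Set.mem_univ (-S)) (Set.mem_univ 0) hp0 (sub_nonneg.2 hp1)
    (by ring)
  simp only [smul_eq_mul, Real.exp_zero, mul_one, mul_zero, add_zero] at h
  calc Real.exp (-(n * p * S)) = Real.exp (p * -S) ^ n := by rw [← Real.exp_nat_mul]; ring_nf
    _ ≤ _ := by gcongr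

/-- Bernoulli's inequality after dropping the exponential. The bound is uniform in `S`, hence in
`m`. -/
theorem one_sub_le_convex_pow {p S : ℝ} (hp0 : 0 ≤ p) (hp1 : p ≤ 1) (n : ℕ) :
    1 - n * p ≤ (p * Real.exp (-S) + (1 - p)) ^ n := by
  have h := one_add_mul_le_pow (by linarith : -2 ≤ -p) n
  calc 1 - n * p = 1 + n * -p := by ring
    _ ≤ (1 + -p) ^ n := h
    _ ≤ _ := by
      refine pow_le_pow_left₀ (by linarith) ?_ n
      have := mul_nonneg hp0 (Real.exp_pos (-S)).le
      linarith

theorem exists_rpow_le {e ρ : ℝ} (he : 0 < e) (hρ : 0 < ρ) :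
    ∃ N : ℕ, 0 < N ∧ ∀ x : ℝ, N ≤ x → (1 / x) ^ e ≤ ρ := by
  refine ⟨⌈(1 / ρ) ^ (1 / e)⌉₊ + 1, by omega, fun x hx => ?_⟩
  have hpos : 0 < (1 / ρ) ^ (1 / e) := by positivity
  have h1 : (1 / ρ) ^ (1 / e) ≤ x := by
    have := Nat.le_ceil ((1 / ρ) ^ (1 / e))
    push_cast at hx
    linarith
  have hx0 : 0 < x := hpos.trans_le h1
  have h2 := Real.rpow_le_rpow hpos.le h1 he.le
  rw [← Real.rpow_mul (by positivity), one_div_mul_cancel he.ne', Real.rpow_one] at h2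
  rw [Real.div_rpow zero_le_one hx0.le, Real.one_rpow]
  exact (one_div_le (by positivity) hρ).2 h2

/-- For small `r` there is an admissible mass `p` of order at most `r ^ b`. -/
theorem exists_mass {a b : ℝ} (ha : 0 < a) (hb : 0 ≤ b) :
    ∃ r₁ > 0, ∀ r, 0 < r → r ≤ r₁ → ∃ p, 0 < p ∧ (p = 1 ∨ p ≤ 1 / 2 ∧ a * r ^ b ≤ p) ∧
      p ≤ (a + 1) * r ^ b := by
  rcases hb.eq_or_lt with rfl | hb
  -- For `b = 0` shrinking `r` does not lower `a * r ^ b = a`, so all the mass is put at `0`.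
  · exact ⟨1, one_pos, fun r _ _ => ⟨1, one_pos, Or.inl rfl, by simp [ha.le]⟩⟩
  · refine ⟨(1 / (2 * a)) ^ (1 / b), by positivity, fun r hr hr₁ => ?_⟩
    have h := Real.rpow_le_rpow hr.le hr₁ hb.le
    rw [← Real.rpow_mul (by positivity), one_div_mul_cancel hb.ne', Real.rpow_one] at h
    have hrb : 0 < r ^ b := by positivity
    refine ⟨a * r ^ b, by positivity, Or.inr ⟨?_, le_rfl⟩, by linarith⟩
    calc a * r ^ b ≤ a * (1 / (2 * a)) := by gcongr
      _ = 1 / 2 := by field_simp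

section Rates

variable {D : ℕ} {L M a b T σ : ℝ}

theorem exists_lower_bound_joint (i : Fin D) (hL : 0 < L) (hM : 0 < M) (ha : 0 < a) (hb : 0 ≤ b)
    (hT : 0 < T) (hσ : 0 < σ) : ∃ K > 0, ∃ N : ℕ, 0 < N ∧ ∀ n m : ℕ, N ≤ n → N ≤ m →
      ENNReal.ofReal (K * (1 / ((n : ℝ) * m)) ^ (1 / (5 + b))) ≤
        minimaxRisk D n m L M a b T σ := by
  obtain ⟨c₀, hc₀, r₀, hr₀, C, hC, w, hw, H⟩ :=
    exists_lower_bound i hL hM ha hb hT hσ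
  obtain ⟨r₁, hr₁, Hp⟩ := exists_mass ha hb
  obtain ⟨N, hN0, hN⟩ := exists_rpow_le (e := 1 / (5 + b)) (by positivity) (lt_min hr₀ hr₁)
  refine ⟨c₀ * Real.exp (-((a + 1) * C)), by positivity, N, hN0, fun n m hn hm => ?_⟩
  have hn0 : (0 : ℝ) < n := by exact_mod_cast hN0.trans_le hn
  have hm0 : (0 : ℝ) < m := by exact_mod_cast hN0.trans_le hm
  have hm1 : (1 : ℝ) ≤ m := by exact_mod_cast hN0.trans_le hm
  have hnm : (N : ℝ) ≤ n * m := by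
    have : (N : ℝ) ≤ n := by exact_mod_cast hn
    nlinarith
  set r := (1 / ((n : ℝ) * m)) ^ (1 / (5 + b)) with hr
  have hr0 : 0 < r := by positivity
  have hrle : r ≤ min r₀ r₁ := hN _ hnm
  have hpow : r ^ 5 * r ^ b = 1 / (n * m) := by
    rw [← Real.rpow_natCast r 5, ← Real.rpow_add hr0, hr, ← Real.rpow_mul (by positivity)]
    norm_num
    rw [inv_mul_cancel₀ (by positivity), Real.rpow_one]
  obtain ⟨p, hp0, hp, hpr⟩ := Hp r hr0 (hrle.trans (min_le_right _ _))
  have hp1 : p ≤ 1 := by rcases hp with rfl | ⟨h, -⟩ <;> linarith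
  obtain ⟨S, hS0, hS, -, h⟩ := H r hr0 (hrle.trans (min_le_left _ _)) p hp0 hp n m
    (hN0.trans_le hm)
  refine (ENNReal.ofReal_le_ofReal ?_).trans h
  have hkey : n * p * S ≤ (a + 1) * C := by
    calc n * p * S ≤ n * ((a + 1) * r ^ b) * (C * (m * r ^ 5)) := by gcongr
      _ = (a + 1) * C * (n * m * (r ^ 5 * r ^ b)) := by ring
      _ = (a + 1) * C := by rw [hpow]; field_simp
  calc c₀ * Real.exp (-((a + 1) * C)) * r = c₀ * r * Real.exp (-((a + 1) * C)) := by ring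
    _ ≤ c₀ * r * Real.exp (-(n * p * S)) := by gcongr
    _ ≤ _ := by gcongr; exact exp_le_convex_pow hp0.le hp1 n

theorem exists_lower_bound_time (i : Fin D) (hL : 0 < L) (hM : 0 < M) (ha : 0 < a) (hb : 0 ≤ b)
    (hT : 0 < T) (hσ : 0 < σ) : ∃ K > 0, ∃ N : ℕ, 0 < N ∧ ∀ n m : ℕ, N ≤ n → N ≤ m →
      ENNReal.ofReal (K * (1 / (m : ℝ))) ≤ minimaxRisk D n m L M a b T σ := by
  obtain ⟨c₀, hc₀, r₀, hr₀, C, hC, w, hw, H⟩ :=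
    exists_lower_bound i hL hM ha hb hT hσ
  obtain ⟨N, hN0, hN⟩ := exists_rpow_le one_pos (div_pos hr₀ hw)
  refine ⟨c₀ * w, by positivity, N, hN0, fun n m hn hm => ?_⟩
  have hm0 : (0 : ℝ) < m := by exact_mod_cast hN0.trans_le hm
  have hr : w / m ≤ r₀ := by
    have := hN m (by exact_mod_cast hm)
    rw [Real.rpow_one, le_div_iff₀ hw] at this
    calc w / m = 1 / m * w := by ring
      _ ≤ r₀ := this
  obtain ⟨S, -, -, hS, h⟩ := H (w / m) (by positivity) hr 1 one_pos (Or.inl rfl) n m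
    (hN0.trans_le hm)
  refine le_trans (le_of_eq ?_) h
  rw [hS le_rfl]
  simp
  ring_nf

theorem exists_lower_bound_space (i : Fin D) (hL : 0 < L) (hM : 0 < M) (ha : 0 < a) (hb : 0 < b)
    (hT : 0 < T) (hσ : 0 < σ) : ∃ K > 0, ∃ N : ℕ, 0 < N ∧ ∀ n m : ℕ, N ≤ n → N ≤ m →
      ENNReal.ofReal (K * (1 / (n : ℝ)) ^ (1 / b)) ≤ minimaxRisk D n m L M a b T σ := by
  obtain ⟨c₀, hc₀, r₀, hr₀, C, hC, w, hw, H⟩ :=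
    exists_lower_bound i hL hM ha hb.le hT hσ
  -- This normalization gives `a * r ^ b = 1 / (2 * n)`, the least mass that standardness permits
  -- here.
  set k := (1 / (2 * a)) ^ (1 / b) with hk
  have hk0 : 0 < k := by positivity
  obtain ⟨N, hN0, hN⟩ := exists_rpow_le (one_div_pos.2 hb) (div_pos hr₀ hk0)
  refine ⟨c₀ * k / 2, by positivity, N, hN0, fun n m hn hm => ?_⟩
  have hn0 : (0 : ℝ) < n := by exact_mod_cast hN0.trans_le hn
  have hn1 : (1 : ℝ) ≤ n := by exact_mod_cast hN0.trans_le hn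
  set r := k * (1 / (n : ℝ)) ^ (1 / b) with hr
  have hr0 : 0 < r := by positivity
  have hrr : r ≤ r₀ := by
    have := hN n (by exact_mod_cast hn)
    rw [le_div_iff₀ hk0] at this
    rw [hr, mul_comm]
    exact this
  have hrb : a * r ^ b = 1 / (2 * n) := by
    rw [hr, hk, ← Real.mul_rpow (by positivity) (by positivity), ← Real.rpow_mul (by positivity),
      one_div_mul_cancel hb.ne', Real.rpow_one]
    field_simp
  have hp2 : 1 / (2 * (n : ℝ)) ≤ 1 / 2 := by
    apply one_div_le_one_div_of_le <;> linarith
  obtain ⟨S, hS0, hS, -, h⟩ := H r hr0 hrr (1 / (2 * n)) (by positivity)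
    (Or.inr ⟨hp2, hrb.le⟩) n m (hN0.trans_le hm)
  refine (ENNReal.ofReal_le_ofReal ?_).trans h
  have h1 := one_sub_le_convex_pow (S := S) (by positivity : 0 ≤ 1 / (2 * (n : ℝ)))
    (by linarith) n
  have h2 : 1 - (n : ℝ) * (1 / (2 * n)) = 1 / 2 := by field_simp; norm_num
  rw [h2] at h1
  calc c₀ * k / 2 * (1 / (n : ℝ)) ^ (1 / b) = c₀ * r * (1 / 2) := by rw [hr]; ring
    _ ≤ _ := by gcongr

end Rates

end OdeRegression

theorem theorem2 (D : ℕ) (L M a b T σ : ℝ) (hL : 0 < L) (hM : 0 < M) (ha : 0 < a)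
    (hb : 0 ≤ b) (hbD : b ≤ (D : ℝ) - 1) (hT : 0 < T) (hσ : 0 < σ) :
    ∃ K : ℝ, 0 < K ∧ ∃ N : ℕ, ∀ n m : ℕ, N ≤ n → N ≤ m →
      ENNReal.ofReal (K * OdeRegression.rate n m b) ≤
        OdeRegression.minimaxRisk D n m L M a b T σ := by
  -- The bounds on `b` force `D ≥ 1`, which provides an axis for the slab.
  have hD : 0 < D := by
    have : (0 : ℝ) < D := by linarith
    exact_mod_cast this
  obtain ⟨K₁, hK₁, N₁, -, H₁⟩ :=
    OdeRegression.exists_lower_bound_joint ⟨0, hD⟩ hL hM ha hb hT hσ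
  obtain ⟨K₂, hK₂, N₂, -, H₂⟩ :=
    OdeRegression.exists_lower_bound_time ⟨0, hD⟩ hL hM ha hb hT hσ
  obtain ⟨K₃, hK₃, N₃, H₃⟩ : ∃ K > 0, ∃ N : ℕ, ∀ n m : ℕ, N ≤ n → N ≤ m →
      ENNReal.ofReal (K * if b = 0 then 0 else (1 / (n : ℝ)) ^ (1 / b)) ≤
        OdeRegression.minimaxRisk D n m L M a b T σ := by
    by_cases hb0 : b = 0
    · exact ⟨1, one_pos, 0, fun n m _ _ => by simp [hb0]⟩
    · obtain ⟨K, hK, N, -, H⟩ := OdeRegression.exists_lower_bound_space ⟨0, hD⟩ hL hM ha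
        (hb.lt_of_ne' hb0) hT hσ
      exact ⟨K, hK, N, by simpa only [hb0, if_false] using H⟩
  refine ⟨min K₁ (min K₂ K₃), by positivity, max N₁ (max N₂ N₃), fun n m hn hm => ?_⟩
  have key : ∀ K y : ℝ, min K₁ (min K₂ K₃) ≤ K → 0 ≤ y →
      ENNReal.ofReal (K * y) ≤ OdeRegression.minimaxRisk D n m L M a b T σ →
      ENNReal.ofReal (min K₁ (min K₂ K₃) * y) ≤ OdeRegression.minimaxRisk D n m L M a b T σ :=
    fun K y hK hy h => (ENNReal.ofReal_le_ofReal (mul_le_mul_of_nonneg_right hK hy)).trans h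
  simp only [max_le_iff] at hn hm
  rw [OdeRegression.rate, mul_max_of_nonneg _ _ (by positivity),
    mul_max_of_nonneg _ _ (by positivity), ENNReal.ofReal_max, ENNReal.ofReal_max]
  refine max_le ?_ (max_le ?_ ?_)
  · exact key K₁ _ (min_le_left _ _) (by positivity) (H₁ n m hn.1 hm.1)
  · exact key K₃ _ ((min_le_right _ _).trans (min_le_right _ _))
      (by split_ifs <;> positivity) (H₃ n m hn.2.2 hm.2.2)
  · exact key K₂ _ ((min_le_right _ _).trans (min_le_left _ _)) (by positivity)
      (H₂ n m hn.2.1 hm.2.1)
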